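/- Let $\mathcal H^A,\mathcal H^B,\mathcal H^{A'},\mathcal H^{B'}$ be finite-dimensional complex Hilbert spaces. For a normalised pure state $\zeta$ of a bipartite system, let $\sigma(\zeta)$ be its Schmidt coefficients, i.e. the eigenvalues of its reduced density matrix (so they sum to $1$). For a state of dimension $n\ge k\ge 1$, its $k$-th generalised concurrence is $$C_k(\zeta)=\left(\frac{e_k(\sigma(\zeta))}{e_k(1/n,\dots,1/n)}\right)^{1/k},$$ where $e_k$ is the $k$-th elementary symmetric polynomial and $(1/n,\dots,1/n)\in\mathbb R^n$. Let $\psi,\phi\in\mathcal H^A\otimes\mathcal H^B$ and $\chi\in\mathcal H^{A'}\otimes\mathcal H^{B'}$ be normalised pure states such that $\psi\otimes\chi$ can be transformed into $\phi\otimes\chi$ by local operations of the two parties $AA'$ and $BB'$ and classical communication (LOCC, in finitely many rounds), with certainty. Suppose that $\psi$ and $\phi$ each have precisely $d$ nonzero Schmidt coefficients, that $\chi$ has precisely $b$ nonzero Schmidt coefficients, and that $C_d(\psi)\ne C_d(\phi)$. Then, with the concurrences of $\psi$ and $\phi$ taken in dimension $n=d$, $$b\;\ge\;1+\left(\frac{d-1}{d}\right)\frac{\log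 C_{d-1}(\phi)-\log C_{d-1}(\psi)}{\log C_d(\psi)-\log C_d(\phi)} .$$ -/

import Mathlib

open scoped Kronecker Matrix

noncomputable section

/-- A normalised pure state of a bipartite system `ℂ^A ⊗ ℂ^B`, given by its amplitudes
`ζ = ∑ a b, amp a b • |a⟩ ⊗ |b⟩` in a product orthonormal basis. -/
structure PureState (A B : Type) [Fintype A] [Fintype B] where
  amp : Matrix A B ℂ
  normalized : ∑ a, ∑ b, ‖amp a b‖ ^ 2 = 1

namespace PureState

variable {A B A' B' : Type} [Fintype A] [Fintype B] [Fintype A'] [Fintype B']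

/-- The density matrix `|ζ⟩⟨ζ|` on the joint system. -/
def density (ζ : PureState A B) : Matrix (A × B) (A × B) ℂ :=
  Matrix.of fun p q => ζ.amp p.1 p.2 * star (ζ.amp q.1 q.2)

/-- The state `ψ ⊗ χ`, shared so that one party holds `A` and `A'`, the other `B` and `B'`. -/
def tensor (ψ : PureState A B) (χ : PureState A' B') : PureState (A × A') (B × B') where
  amp := ψ.amp ⊗ₖ χ.amp
  normalized := by
    have h : ∑ x : A × A', ∑ y : B × B', ‖(ψ.amp ⊗ₖ χ.amp) x y‖ ^ 2
        = (∑ a, ∑ b, ‖ψ.amp a b‖ ^ 2) * (∑ a, ∑ b, ‖χ.amp a b‖ ^ 2) := by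
      simp only [Matrix.kroneckerMap_apply, norm_mul, mul_pow]
      rw [Fintype.sum_prod_type, Finset.sum_mul_sum]
      refine Finset.sum_congr rfl fun a _ => Finset.sum_congr rfl fun a' _ => ?_
      rw [Fintype.sum_prod_type, Finset.sum_mul_sum]
    rw [h, ψ.normalized, χ.normalized, one_mul]

/-- The reduced density matrix of the first party, `tr_B |ζ⟩⟨ζ|`. -/
def reduced (ζ : PureState A B) : Matrix A A ℂ :=
  Matrix.of fun a a' => ∑ b, ζ.density (a, b) (a', b)

lemma reduced_eq (ζ : PureState A B) : ζ.reduced = ζ.amp * ζ.ampᴴ := by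
  ext a a'
  simp [reduced, density, Matrix.mul_apply]

lemma reduced_isHermitian (ζ : PureState A B) : ζ.reduced.IsHermitian := by
  rw [reduced_eq]
  exact Matrix.isHermitian_mul_conjTranspose_self ζ.amp

variable [DecidableEq A]

/-- The Schmidt coefficients, normalised to sum `1`: the eigenvalues, with multiplicity, of the
reduced density matrix (the squares of the coefficients in a Schmidt decomposition). There may be
additional zeros, which change no elementary symmetric polynomial. -/
def schmidtCoeffs (ζ : PureState A B) : Multiset ℝ :=
  Finset.univ.val.map ζ.reduced_isHermitian.eigenvalues

/-- The number of nonzero Schmidt coefficients. -/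
def schmidtRank (ζ : PureState A B) : ℕ :=
  (ζ.schmidtCoeffs.filter fun x => x ≠ 0).card

/-- The `k`-th generalised concurrence of `ζ` as a state of dimension `n`:
`(e_k(σ(ζ)) / e_k(1/n, …, 1/n)) ^ (1/k)`. -/
def concurrence (n k : ℕ) (ζ : PureState A B) : ℝ :=
  (ζ.schmidtCoeffs.esymm k / (Multiset.replicate n (1 / (n : ℝ))).esymm k) ^ (1 / (k : ℝ))

end PureState

/-- `IsLOCC A₂ B₂ A B Λ`: the map `Λ`, from density matrices on `A × B` to density matrices on
`A₂ × B₂`, is realised by a protocol of finitely many rounds of local operations and classical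
communication. In each round one party performs a general measurement with Kraus operators `K i`,
`∑ i, (K i)ᴴ * K i = 1` (possibly into another space, so that adding and discarding local systems
and local unitaries are included), and announces the outcome `i`, on which the rest `Λ i` of the
protocol may depend. At the end the outcomes are forgotten. -/
inductive IsLOCC (A₂ B₂ : Type) [Fintype A₂] [DecidableEq A₂] [Fintype B₂] [DecidableEq B₂] :
    (A B : Type) → [Fintype A] → [DecidableEq A] → [Fintype B] → [DecidableEq B] →
    (Matrix (A × B) (A × B) ℂ → Matrix (A₂ × B₂) (A₂ × B₂) ℂ) → Prop
  | done : IsLOCC A₂ B₂ A₂ B₂ fun ρ => ρ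
  | alice {A B I : Type} [Fintype A] [DecidableEq A] [Fintype B] [DecidableEq B] [Fintype I]
      {A' : I → Type} [∀ i, Fintype (A' i)] [∀ i, DecidableEq (A' i)]
      (K : ∀ i, Matrix (A' i) A ℂ) (hK : ∑ i, (K i)ᴴ * K i = 1)
      (Λ : ∀ i, Matrix (A' i × B) (A' i × B) ℂ → Matrix (A₂ × B₂) (A₂ × B₂) ℂ)
      (hΛ : ∀ i, IsLOCC A₂ B₂ (A' i) B (Λ i)) :
      IsLOCC A₂ B₂ A B fun ρ =>
        ∑ i, Λ i ((K i ⊗ₖ (1 : Matrix B B ℂ)) * ρ * (K i ⊗ₖ (1 : Matrix B B ℂ))ᴴ)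
  | bob {A B I : Type} [Fintype A] [DecidableEq A] [Fintype B] [DecidableEq B] [Fintype I]
      {B' : I → Type} [∀ i, Fintype (B' i)] [∀ i, DecidableEq (B' i)]
      (K : ∀ i, Matrix (B' i) B ℂ) (hK : ∑ i, (K i)ᴴ * K i = 1)
      (Λ : ∀ i, Matrix (A × B' i) (A × B' i) ℂ → Matrix (A₂ × B₂) (A₂ × B₂) ℂ)
      (hΛ : ∀ i, IsLOCC A₂ B₂ A (B' i) (Λ i)) :
      IsLOCC A₂ B₂ A B fun ρ =>
        ∑ i, Λ i (((1 : Matrix A A ℂ) ⊗ₖ K i) * ρ * ((1 : Matrix A A ℂ) ⊗ₖ K i)ᴴ)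

/-- `ψ ↦ φ` by LOCC: some LOCC operation maps `|ψ⟩⟨ψ|` to `|φ⟩⟨φ|` (with certainty). -/
def LOCCConvertible {A B A₂ B₂ : Type} [Fintype A] [DecidableEq A] [Fintype B] [DecidableEq B]
    [Fintype A₂] [DecidableEq A₂] [Fintype B₂] [DecidableEq B₂]
    (ψ : PureState A B) (φ : PureState A₂ B₂) : Prop :=
  ∃ Λ : Matrix (A × B) (A × B) ℂ → Matrix (A₂ × B₂) (A₂ × B₂) ℂ,
    IsLOCC A₂ B₂ A B Λ ∧ Λ ψ.density = φ.density

end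

open scoped Kronecker Matrix

/-! The root `e_k ^ (1/k)` is superadditive and homogeneous of degree one on nonnegative vectors, so
it increases under doubly stochastic matrices. Applied to spectra, this makes it an entanglement
monotone. A local measurement splits one Gram matrix of the amplitude matrix into a sum of positive
matrices, so the average root over outcomes cannot grow (`sum_esymmRoot_eigenvalues_le`). If the
final state is pure, every branch is proportional to it, and `LOCCConvertible.esymm_le` follows.

Use this monotone on the catalysed states for `k = d * b` and `k = d * b - 1`. Write P, Q, G for the
products and S, T, R for the sums of inverses of the nonzero Schmidt coefficients of ψ, φ, χ. The
top function is the full product `P^b G^d`, and the next one is that product times the sum of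
inverses `S R`. Both factor, so χ cancels except through its rank: `Q ≤ P` and `Q^b T ≤ P^b S`.
Taking logarithms, `b ≥ (log T - log S) / (log P - log Q)`, which is the claimed bound once the
concurrences are written through P, Q, S, T. -/

theorem Multiset.esymm_zero_right {R : Type*} [CommSemiring R] (s : Multiset R) :
    s.esymm 0 = 1 := by
  simp [Multiset.esymm]

theorem Multiset.esymm_cons_succ {R : Type*} [CommSemiring R] (a : R) (s : Multiset R) (k : ℕ) :
    (a ::ₘ s).esymm (k + 1) = s.esymm (k + 1) + a * s.esymm k := by
  simp [Multiset.esymm, Multiset.powersetCard_cons, Multiset.sum_map_mul_left]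

theorem Multiset.esymm_nonneg {s : Multiset ℝ} (hs : ∀ x ∈ s, 0 ≤ x) (k : ℕ) :
    0 ≤ s.esymm k := by
  refine Multiset.sum_nonneg fun y hy => ?_
  obtain ⟨t, ht, rfl⟩ := Multiset.mem_map.1 hy
  exact Multiset.prod_nonneg fun a ha =>
    hs a (Multiset.mem_of_le (Multiset.mem_powersetCard.1 ht).1 ha)

/-- If an elementary symmetric function of nonnegative numbers vanishes, so does the next one. -/
theorem Multiset.esymm_succ_eq_zero {s : Multiset ℝ} (hs : ∀ x ∈ s, 0 ≤ x) {k : ℕ}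
    (h : s.esymm k = 0) : s.esymm (k + 1) = 0 := by
  induction s using Multiset.induction_on generalizing k with
  | empty => simp [Multiset.esymm, Multiset.powersetCard_zero_right]
  | cons a s ih =>
    have hs' : ∀ x ∈ s, 0 ≤ x := fun x hx => hs x (Multiset.mem_cons_of_mem hx)
    have ha : 0 ≤ a := hs a (Multiset.mem_cons_self a s)
    cases k with
    | zero => simp [Multiset.esymm_zero_right] at h
    | succ k =>
      rw [Multiset.esymm_cons_succ] at h ⊢
      have h1 := Multiset.esymm_nonneg hs' (k + 1)
      have h2 := mul_nonneg ha (Multiset.esymm_nonneg hs' k)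
      have h3 : s.esymm (k + 1) = 0 := by linarith
      rw [ih hs' h3, h3]
      simp

/-! ### Superadditivity and Schur concavity of roots of elementary symmetric functions. -/

section ElementarySymmetric

variable {ι : Type*}

/-- The elementary symmetric function of the values of `x` on a finite set. -/
noncomputable def esymmOn (s : Finset ι) (k : ℕ) (x : ι → ℝ) : ℝ :=
  (s.val.map x).esymm k

theorem esymmOn_zero (s : Finset ι) (x : ι → ℝ) : esymmOn s 0 x = 1 :=
  Multiset.esymm_zero_right _

theorem esymmOn_nonneg {s : Finset ι} {x : ι → ℝ} (hx : ∀ i, 0 ≤ x i) (k : ℕ) :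
    0 ≤ esymmOn s k x := by
  refine Multiset.esymm_nonneg (fun y hy => ?_) k
  obtain ⟨i, -, rfl⟩ := Multiset.mem_map.1 hy
  exact hx i

theorem esymmOn_succ_eq_zero {s : Finset ι} {x : ι → ℝ} (hx : ∀ i, 0 ≤ x i) {k : ℕ}
    (h : esymmOn s k x = 0) : esymmOn s (k + 1) x = 0 := by
  refine Multiset.esymm_succ_eq_zero (fun y hy => ?_) h
  obtain ⟨i, -, rfl⟩ := Multiset.mem_map.1 hy
  exact hx i

theorem esymmOn_insert [DecidableEq ι] {s : Finset ι} {a : ι} (ha : a ∉ s) (k : ℕ) (x : ι → ℝ) :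
    esymmOn (insert a s) (k + 1) x = esymmOn s (k + 1) x + x a * esymmOn s k x := by
  simp only [esymmOn, Finset.insert_val_of_notMem ha, Multiset.map_cons,
    Multiset.esymm_cons_succ]

theorem esymmOn_erase [DecidableEq ι] {s : Finset ι} {a : ι} (ha : a ∈ s) (k : ℕ) (x : ι → ℝ) :
    esymmOn s (k + 1) x = esymmOn (s.erase a) (k + 1) x + x a * esymmOn (s.erase a) k x := by
  rw [← esymmOn_insert (Finset.notMem_erase a s), Finset.insert_erase ha]

/-- Euler's identity for elementary symmetric functions. -/
theorem esymmOn_euler [DecidableEq ι] (s : Finset ι) (k : ℕ) (x : ι → ℝ) :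
    (k + 1 : ℝ) * esymmOn s (k + 1) x = ∑ i ∈ s, x i * esymmOn (s.erase i) k x := by
  induction s using Finset.induction_on generalizing k with
  | empty => simp [esymmOn, Multiset.esymm, Multiset.powersetCard_zero_right]
  | insert a s ha ih =>
    rw [Finset.sum_insert ha, Finset.erase_insert ha, esymmOn_insert ha]
    have herase : ∀ i ∈ s, (insert a s).erase i = insert a (s.erase i) := fun i hi =>
      Finset.erase_insert_of_ne fun h => ha (h ▸ hi)
    have hnot : ∀ i, a ∉ s.erase i := fun i h => ha (Finset.mem_of_mem_erase h)
    cases k with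
    | zero =>
      have h := ih 0
      simp only [esymmOn_zero] at h ⊢
      push_cast at h ⊢
      linarith
    | succ k =>
      have h1 := ih (k + 1)
      have h2 := ih k
      have h3 : ∑ i ∈ s, x i * esymmOn ((insert a s).erase i) (k + 1) x
          = ∑ i ∈ s, x i * esymmOn (s.erase i) (k + 1) x
            + x a * ∑ i ∈ s, x i * esymmOn (s.erase i) k x := by
        rw [Finset.mul_sum, ← Finset.sum_add_distrib]
        refine Finset.sum_congr rfl fun i hi => ?_
        rw [herase i hi, esymmOn_insert (hnot i)]
        ring
      rw [h3, ← h1, ← h2]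
      push_cast
      ring

/-- Ratio of consecutive elementary symmetric functions. -/
noncomputable def esymmRatio (s : Finset ι) (k : ℕ) (x : ι → ℝ) : ℝ :=
  esymmOn s (k + 1) x / esymmOn s k x

theorem esymmRatio_nonneg {s : Finset ι} {x : ι → ℝ} (hx : ∀ i, 0 ≤ x i) (k : ℕ) :
    0 ≤ esymmRatio s k x :=
  div_nonneg (esymmOn_nonneg hx _) (esymmOn_nonneg hx _)

/-- Euler's identity in the numerator and the split of `e_{k+1}` at each index in the denominator
turn every term into a parallel sum `ab / (a + b)`. This recursion lets concavity pass from one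
ratio to the next. -/
theorem esymmRatio_succ [DecidableEq ι] {s : Finset ι} {x : ι → ℝ} (hx : ∀ i, 0 ≤ x i) (k : ℕ) :
    (k + 2 : ℝ) * esymmRatio s (k + 1) x
      = ∑ i ∈ s, x i * esymmRatio (s.erase i) k x / (x i + esymmRatio (s.erase i) k x) := by
  have h := esymmOn_euler s (k + 1) x
  push_cast at h
  rw [esymmRatio, ← mul_div_assoc, show (k + 2 : ℝ) = k + 1 + 1 by ring, h, Finset.sum_div]
  refine Finset.sum_congr rfl fun i hi => ?_
  rw [esymmOn_erase hi k x, esymmRatio]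
  have h1 : 0 ≤ esymmOn (s.erase i) k x := esymmOn_nonneg hx k
  -- If `e_k` of the remaining variables vanishes, so does `e_{k+1}`, and both sides are zero under
  -- the convention `x / 0 = 0`.
  rcases h1.eq_or_lt with h0 | h0
  · rw [esymmOn_succ_eq_zero hx h0.symm]
    simp
  · have h2 : 0 ≤ esymmOn (s.erase i) (k + 1) x := esymmOn_nonneg hx _
    have hxi := hx i
    have h3 : x i + esymmOn (s.erase i) (k + 1) x / esymmOn (s.erase i) k x
        = (esymmOn (s.erase i) (k + 1) x + x i * esymmOn (s.erase i) k x)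
          / esymmOn (s.erase i) k x := by
      field_simp
      ring
    rw [h3, ← mul_div_assoc, div_div_div_cancel_right₀ h0.ne']

/-- After clearing denominators the difference of the two sides is the square `(a * d - b * c) ^ 2`.
-/
theorem parallelSum_superadditive {a b c d : ℝ} (ha : 0 ≤ a) (hb : 0 ≤ b) (hc : 0 ≤ c)
    (hd : 0 ≤ d) :
    a * b / (a + b) + c * d / (c + d) ≤ (a + c) * (b + d) / ((a + c) + (b + d)) := by
  rcases (add_nonneg ha hb).eq_or_lt with h | h
  · obtain rfl : a = 0 := by linarith
    obtain rfl : b = 0 := by linarith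
    simp
  rcases (add_nonneg hc hd).eq_or_lt with h' | h'
  · obtain rfl : c = 0 := by linarith
    obtain rfl : d = 0 := by linarith
    simp
  rw [div_add_div _ _ h.ne' h'.ne', div_le_div_iff₀ (by positivity) (by linarith)]
  nlinarith [sq_nonneg (a * d - b * c)]

theorem parallelSum_mono {a b c : ℝ} (ha : 0 ≤ a) (hb : 0 ≤ b) (h : b ≤ c) :
    a * b / (a + b) ≤ a * c / (a + c) := by
  rcases ha.eq_or_lt with rfl | ha
  · simp
  rw [div_le_div_iff₀ (by linarith) (by linarith)]
  nlinarith [mul_pos ha ha]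

/-- Induction on `k`: the first ratio is the linear function `∑ x i`, and the recursion builds each
later one from parallel sums, which are superadditive and monotone. The set varies because the
recursion erases an index. -/
theorem esymmRatio_superadditive [DecidableEq ι] (k : ℕ) (s : Finset ι) {x y : ι → ℝ}
    (hx : ∀ i, 0 ≤ x i) (hy : ∀ i, 0 ≤ y i) :
    esymmRatio s k x + esymmRatio s k y ≤ esymmRatio s k (x + y) := by
  have hxy : ∀ i, 0 ≤ (x + y) i := fun i => add_nonneg (hx i) (hy i)
  induction k generalizing s with
  | zero =>
    refine le_of_eq ?_
    have h : ∀ z : ι → ℝ, esymmRatio s 0 z = ∑ i ∈ s, z i := fun z => by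
      have := esymmOn_euler s 0 z
      simpa [esymmRatio, esymmOn_zero] using this
    simp [h, Finset.sum_add_distrib]
  | succ k ih =>
    have hk : (0 : ℝ) < k + 2 := by positivity
    refine le_of_mul_le_mul_left ?_ hk
    rw [mul_add, esymmRatio_succ hx, esymmRatio_succ hy, esymmRatio_succ hxy,
      ← Finset.sum_add_distrib]
    refine Finset.sum_le_sum fun i _ => ?_
    have h1 := esymmRatio_nonneg (s := s.erase i) hx k
    have h2 := esymmRatio_nonneg (s := s.erase i) hy k
    exact (parallelSum_superadditive (hx i) h1 (hy i) h2).trans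
      (parallelSum_mono (hxy i) (add_nonneg h1 h2) (ih _))

theorem esymmOn_eq_prod_esymmRatio (s : Finset ι) {x : ι → ℝ} (hx : ∀ i, 0 ≤ x i) (k : ℕ) :
    esymmOn s k x = ∏ j ∈ Finset.range k, esymmRatio s j x := by
  induction k with
  | zero => simp [esymmOn_zero]
  | succ k ih =>
    rw [Finset.prod_range_succ, ← ih, esymmRatio]
    by_cases h : esymmOn s k x = 0
    · rw [esymmOn_succ_eq_zero hx h, h, zero_mul]
    · rw [mul_div_cancel₀ _ h]

/-- Superadditivity of the geometric mean: apply AM-GM to the fractions `a i / (a i + b i)` and `b i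
/ (a i + b i)`, whose arithmetic means add up to one. -/
theorem prod_rpow_superadditive {s : Finset ι} (hs : s.Nonempty) {a b : ι → ℝ}
    (ha : ∀ i ∈ s, 0 ≤ a i) (hb : ∀ i ∈ s, 0 ≤ b i) :
    (∏ i ∈ s, a i) ^ (1 / (s.card : ℝ)) + (∏ i ∈ s, b i) ^ (1 / (s.card : ℝ))
      ≤ (∏ i ∈ s, (a i + b i)) ^ (1 / (s.card : ℝ)) := by
  have hc : (0 : ℝ) < s.card := by exact_mod_cast hs.card_pos
  have hr : (1 / (s.card : ℝ)) ≠ 0 := by positivity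
  by_cases h0 : ∃ i ∈ s, a i + b i = 0
  · obtain ⟨i, hi, h⟩ := h0
    have hai : a i = 0 := by linarith [ha i hi, hb i hi]
    have hbi : b i = 0 := by linarith [ha i hi, hb i hi]
    rw [Finset.prod_eq_zero hi hai, Finset.prod_eq_zero hi hbi, Finset.prod_eq_zero hi h,
      Real.zero_rpow hr, add_zero]
  · push Not at h0
    have hpos : ∀ i ∈ s, 0 < a i + b i := fun i hi =>
      lt_of_le_of_ne (add_nonneg (ha i hi) (hb i hi)) (h0 i hi).symm
    have key : ∀ c : ι → ℝ, (∀ i ∈ s, 0 ≤ c i) →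
        (∏ i ∈ s, c i) ^ (1 / (s.card : ℝ))
          ≤ (∑ i ∈ s, 1 / (s.card : ℝ) * (c i / (a i + b i)))
            * (∏ i ∈ s, (a i + b i)) ^ (1 / (s.card : ℝ)) := fun c hcn => by
      have h1 := Real.geom_mean_le_arith_mean_weighted s (fun _ => 1 / (s.card : ℝ))
        (fun i => c i / (a i + b i)) (fun i _ => by positivity)
        (by rw [Finset.sum_const, nsmul_eq_mul]; field_simp)
        (fun i hi => div_nonneg (hcn i hi) (hpos i hi).le)
      rw [Real.finsetProd_rpow _ _ fun i hi => div_nonneg (hcn i hi) (hpos i hi).le,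
        Finset.prod_div_distrib, Real.div_rpow (Finset.prod_nonneg hcn)
          (Finset.prod_nonneg fun i hi => (hpos i hi).le),
        div_le_iff₀ (Real.rpow_pos_of_pos (Finset.prod_pos hpos) _)] at h1
      exact h1
    have h1 : (∑ i ∈ s, 1 / (s.card : ℝ) * (a i / (a i + b i)))
        + ∑ i ∈ s, 1 / (s.card : ℝ) * (b i / (a i + b i)) = 1 := by
      rw [← Finset.sum_add_distrib]
      have : ∀ i ∈ s, 1 / (s.card : ℝ) * (a i / (a i + b i))
          + 1 / (s.card : ℝ) * (b i / (a i + b i)) = 1 / (s.card : ℝ) := fun i hi => by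
        rw [← mul_add, ← add_div, div_self (h0 i hi), mul_one]
      rw [Finset.sum_congr rfl this, Finset.sum_const, nsmul_eq_mul]
      field_simp
    calc _ ≤ _ := add_le_add (key a ha) (key b hb)
      _ = _ := by rw [← add_mul, h1, one_mul]

/-- The `k`-th root of the `k`-th elementary symmetric function of a real vector. -/
noncomputable def esymmRoot [Fintype ι] (k : ℕ) (x : ι → ℝ) : ℝ :=
  esymmOn Finset.univ k x ^ (1 / (k : ℝ))

/-- By telescoping, the root is the geometric mean of `k` superadditive ratios. -/
theorem esymmRoot_superadditive [Fintype ι] [DecidableEq ι] {k : ℕ} (hk : k ≠ 0) {x y : ι → ℝ}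
    (hx : ∀ i, 0 ≤ x i) (hy : ∀ i, 0 ≤ y i) :
    esymmRoot k x + esymmRoot k y ≤ esymmRoot k (x + y) := by
  have hxy : ∀ i, 0 ≤ (x + y) i := fun i => add_nonneg (hx i) (hy i)
  have h := prod_rpow_superadditive (s := Finset.range k)
    (a := fun j => esymmRatio Finset.univ j x) (b := fun j => esymmRatio Finset.univ j y)
    (by simpa using hk) (fun j _ => esymmRatio_nonneg hx j) (fun j _ => esymmRatio_nonneg hy j)
  rw [Finset.card_range] at h
  simp only [esymmRoot, esymmOn_eq_prod_esymmRatio _ hx, esymmOn_eq_prod_esymmRatio _ hy,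
    esymmOn_eq_prod_esymmRatio _ hxy]
  refine h.trans (Real.rpow_le_rpow (Finset.prod_nonneg fun j _ =>
    add_nonneg (esymmRatio_nonneg hx j) (esymmRatio_nonneg hy j))
    (Finset.prod_le_prod (fun j _ =>
      add_nonneg (esymmRatio_nonneg hx j) (esymmRatio_nonneg hy j)) fun j _ =>
        esymmRatio_superadditive j _ hx hy) (by positivity))

theorem esymmOn_smul (s : Finset ι) (k : ℕ) (c : ℝ) (x : ι → ℝ) :
    esymmOn s k (c • x) = c ^ k * esymmOn s k x := by
  have h := Multiset.pow_smul_esymm c k (s.val.map x)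
  rw [Multiset.map_map] at h
  exact h.symm

theorem esymmRoot_smul [Fintype ι] {k : ℕ} (hk : k ≠ 0) {c : ℝ} (hc : 0 ≤ c) {x : ι → ℝ}
    (hx : ∀ i, 0 ≤ x i) : esymmRoot k (c • x) = c * esymmRoot k x := by
  rw [esymmRoot, esymmRoot, esymmOn_smul, Real.mul_rpow (pow_nonneg hc _) (esymmOn_nonneg hx _),
    one_div, Real.pow_rpow_inv_natCast hc hk]

theorem sum_esymmRoot_le [Fintype ι] [DecidableEq ι] {k : ℕ} (hk : k ≠ 0) {J : Type*} (t : Finset J)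
    {x : J → ι → ℝ} (hx : ∀ j i, 0 ≤ x j i) :
    ∑ j ∈ t, esymmRoot k (x j) ≤ esymmRoot k (∑ j ∈ t, x j) := by
  classical
  induction t using Finset.induction_on with
  | empty =>
    simp only [Finset.sum_empty]
    exact Real.rpow_nonneg (esymmOn_nonneg (fun _ => le_rfl) _) _
  | insert a t ha ih =>
    rw [Finset.sum_insert ha, Finset.sum_insert ha]
    refine (add_le_add_right ih _).trans (esymmRoot_superadditive hk (hx a) fun i => ?_)
    rw [Finset.sum_apply]
    exact Finset.sum_nonneg fun j _ => hx j i

theorem esymmRoot_comp_perm [Fintype ι] (k : ℕ) (σ : Equiv.Perm ι) (x : ι → ℝ) :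
    esymmRoot k (x ∘ σ) = esymmRoot k x := by
  rw [esymmRoot, esymmRoot, esymmOn, esymmOn, ← Multiset.map_map, Multiset.map_univ_val_equiv]

/-- Schur concavity. -/
theorem esymmRoot_le_mulVec [Fintype ι] [DecidableEq ι] {k : ℕ} (hk : k ≠ 0) {D : Matrix ι ι ℝ}
    (hD : D ∈ doublyStochastic ℝ ι) {x : ι → ℝ} (hx : ∀ i, 0 ≤ x i) :
    esymmRoot k x ≤ esymmRoot k (D *ᵥ x) := by
  -- Birkhoff's theorem reduces to a convex combination of permutations, each of which preserves the
  -- root.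
  obtain ⟨w, hw, hw1, rfl⟩ := exists_eq_sum_perm_of_mem_doublyStochastic hD
  have h : (∑ σ, w σ • σ.permMatrix ℝ) *ᵥ x = ∑ σ, w σ • (x ∘ σ) := by
    rw [Matrix.sum_mulVec]
    refine Finset.sum_congr rfl fun σ _ => ?_
    rw [Matrix.smul_mulVec, Matrix.permMatrix_mulVec]
  rw [h]
  refine le_trans (le_of_eq ?_) (sum_esymmRoot_le hk _ fun σ i => mul_nonneg (hw σ) (hx _))
  rw [← one_mul (esymmRoot k x), ← hw1, Finset.sum_mul]
  refine Finset.sum_congr rfl fun σ _ => ?_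
  rw [esymmRoot_smul hk (hw σ) (x := x ∘ σ) fun i => hx _, esymmRoot_comp_perm]

end ElementarySymmetric

/-! ### Spectra of positive semidefinite matrices and Gram matrices under measurement. -/

section Spectrum

open scoped ComplexOrder

variable {m n : Type*} [Fintype m] [Fintype n]

theorem Matrix.IsHermitian.map_eigenvalues_eq [DecidableEq n] {H : Matrix n n ℂ}
    (hH : H.IsHermitian) :
    Finset.univ.val.map hH.eigenvalues = H.charpoly.roots.map Complex.re := by
  rw [hH.roots_charpoly_eq_eigenvalues, Multiset.map_map]
  exact Multiset.map_congr rfl fun i _ => by simp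

theorem normSq_unitary_mem_doublyStochastic [DecidableEq n] {W : Matrix n n ℂ}
    (hW : W ∈ Matrix.unitaryGroup n ℂ) :
    (Matrix.of fun i j => Complex.normSq (W i j)) ∈ doublyStochastic ℝ n := by
  rw [mem_doublyStochastic_iff_sum]
  refine ⟨fun i j => Complex.normSq_nonneg _, fun i => ?_, fun j => ?_⟩
  · have h := congrFun (congrFun (Matrix.mem_unitaryGroup_iff.1 hW) i) i
    simp only [Matrix.mul_apply, Matrix.star_apply, Matrix.one_apply_eq, Complex.star_def,
      Complex.mul_conj] at h
    exact_mod_cast h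
  · have h := congrFun (congrFun (Matrix.mem_unitaryGroup_iff'.1 hW) j) j
    simp only [Matrix.mul_apply, Matrix.star_apply, Matrix.one_apply_eq, Complex.star_def,
      Complex.normSq_eq_conj_mul_self.symm] at h
    exact_mod_cast h

theorem re_diag_unitary_conj_diagonal [DecidableEq n] (W : Matrix n n ℂ) (x : n → ℝ) (i : n) :
    ((W * Matrix.diagonal (fun j => (x j : ℂ)) * Wᴴ) i i).re
      = ((Matrix.of fun i j => Complex.normSq (W i j)) *ᵥ x) i := by
  rw [Matrix.mul_apply, Complex.re_sum]
  simp only [Matrix.mul_diagonal, Matrix.conjTranspose_apply, Matrix.mulVec, dotProduct,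
    Matrix.of_apply]
  refine Finset.sum_congr rfl fun j _ => ?_
  rw [mul_right_comm, Complex.star_def, Complex.mul_conj, ← Complex.ofReal_mul,
    Complex.ofReal_re]

theorem Matrix.IsHermitian.eq_conj_diagonal [DecidableEq n] {H : Matrix n n ℂ}
    (hH : H.IsHermitian) :
    H = (hH.eigenvectorUnitary : Matrix n n ℂ)
      * Matrix.diagonal (fun j => (hH.eigenvalues j : ℂ))
      * (hH.eigenvectorUnitary : Matrix n n ℂ)ᴴ := by
  have h := hH.spectral_theorem
  rw [Unitary.conjStarAlgAut_apply] at h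
  exact h

open Polynomial in
theorem Matrix.IsHermitian.map_eigenvalues_of_conj_diagonal [DecidableEq n] {H : Matrix n n ℂ}
    (hH : H.IsHermitian) {W : Matrix n n ℂ} (hW : W ∈ Matrix.unitaryGroup n ℂ) {x : n → ℝ}
    (h : H = W * Matrix.diagonal (fun j => (x j : ℂ)) * Wᴴ) :
    Finset.univ.val.map hH.eigenvalues = Finset.univ.val.map x := by
  have h1 : Wᴴ * W = 1 := Matrix.mem_unitaryGroup_iff'.1 hW
  rw [hH.map_eigenvalues_eq, h, Matrix.charpoly_mul_comm, ← Matrix.mul_assoc, h1, Matrix.one_mul,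
    Matrix.charpoly_diagonal, Polynomial.roots_prod _ _
      (Finset.prod_ne_zero_iff.2 fun i _ => X_sub_C_ne_zero _)]
  simp

/-- The diagonal of a positive semidefinite matrix in any orthonormal basis is majorised by its
spectrum, so its elementary symmetric functions are at least those of the spectrum. -/
theorem esymmRoot_eigenvalues_le_diag [DecidableEq n] {k : ℕ} (hk : k ≠ 0) {H : Matrix n n ℂ}
    (hH : H.PosSemidef) {U : Matrix n n ℂ} (hU : U ∈ Matrix.unitaryGroup n ℂ) :
    esymmRoot k hH.isHermitian.eigenvalues ≤ esymmRoot k fun i => ((Uᴴ * H * U) i i).re := by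
  set V := hH.isHermitian.eigenvectorUnitary
  have hW : Uᴴ * (V : Matrix n n ℂ) ∈ Matrix.unitaryGroup n ℂ :=
    mul_mem (Unitary.star_mem hU) V.2
  have h : (fun i => ((Uᴴ * H * U) i i).re)
      = (Matrix.of fun i j => Complex.normSq ((Uᴴ * (V : Matrix n n ℂ)) i j))
        *ᵥ hH.isHermitian.eigenvalues := by
    funext i
    rw [← re_diag_unitary_conj_diagonal]
    conv_lhs => rw [hH.isHermitian.eq_conj_diagonal]
    simp only [Matrix.conjTranspose_mul, Matrix.conjTranspose_conjTranspose, Matrix.mul_assoc]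
    rfl
  rw [h]
  exact esymmRoot_le_mulVec hk (normSq_unitary_mem_doublyStochastic hW) hH.eigenvalues_nonneg

/-- In an eigenbasis of `S` the spectrum of `S` is the sum of the diagonals of the `H i`. Passing
from each spectrum to its diagonal raises the root, and superadditivity then compares the sum of
roots with the root of the sum. -/
theorem sum_esymmRoot_eigenvalues_le [DecidableEq n] {k : ℕ} (hk : k ≠ 0) {I : Type*} [Fintype I]
    {H : I → Matrix n n ℂ} (hH : ∀ i, (H i).PosSemidef) {S : Matrix n n ℂ} (hS : S.IsHermitian)
    (hsum : ∑ i, H i = S) :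
    ∑ i, esymmRoot k (hH i).isHermitian.eigenvalues ≤ esymmRoot k hS.eigenvalues := by
  set U : Matrix n n ℂ := hS.eigenvectorUnitary.1
  have hU : U ∈ Matrix.unitaryGroup n ℂ := hS.eigenvectorUnitary.2
  have hdiag : hS.eigenvalues = ∑ i, fun j => ((Uᴴ * H i * U) j j).re := by
    funext j
    have h1 : Uᴴ * S * U = Matrix.diagonal (fun j => (hS.eigenvalues j : ℂ)) := by
      conv_lhs => rw [hS.eq_conj_diagonal]
      have h2 : Uᴴ * U = 1 := Matrix.mem_unitaryGroup_iff'.1 hU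
      calc Uᴴ * (U * Matrix.diagonal (fun j => (hS.eigenvalues j : ℂ)) * Uᴴ) * U
          = (Uᴴ * U) * Matrix.diagonal (fun j => (hS.eigenvalues j : ℂ)) * (Uᴴ * U) := by
            simp only [Matrix.mul_assoc]
        _ = _ := by rw [h2, Matrix.one_mul, Matrix.mul_one]
    have h3 : ((Uᴴ * S * U) j j).re = hS.eigenvalues j := by
      rw [h1, Matrix.diagonal_apply_eq, Complex.ofReal_re]
    rw [← h3, ← hsum, Finset.sum_apply, Matrix.mul_sum, Matrix.sum_mul, Matrix.sum_apply,
      Complex.re_sum]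
  rw [hdiag]
  refine (Finset.sum_le_sum fun i _ => esymmRoot_eigenvalues_le_diag hk (hH i) hU).trans
    (sum_esymmRoot_le hk _ fun i j => ?_)
  have h := ((hH i).conjTranspose_mul_mul_same U).diag_nonneg (i := j)
  exact (Complex.nonneg_iff.1 h).1

theorem Multiset.esymm_zero_cons {R : Type*} [CommSemiring R] (s : Multiset R) (k : ℕ) :
    ((0 : R) ::ₘ s).esymm k = s.esymm k := by
  cases k with
  | zero => simp [Multiset.esymm_zero_right]
  | succ k => simp [Multiset.esymm_cons_succ]

theorem Multiset.esymm_replicate_zero_add {R : Type*} [CommSemiring R] (j : ℕ) (s : Multiset R)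
    (k : ℕ) : (Multiset.replicate j 0 + s).esymm k = s.esymm k := by
  induction j with
  | zero => simp
  | succ j ih => rw [Multiset.replicate_succ, Multiset.cons_add, Multiset.esymm_zero_cons, ih]

-- The two characteristic polynomials agree up to powers of `X`, so the spectra differ only by
-- zeros, which elementary symmetric functions ignore.
open Polynomial in
theorem esymm_eigenvalues_mul_conjTranspose [DecidableEq m] [DecidableEq n]
    (M : Matrix m n ℂ) (k : ℕ) :
    (Finset.univ.val.map (Matrix.isHermitian_mul_conjTranspose_self M).eigenvalues).esymm k
      = (Finset.univ.val.map
          (Matrix.isHermitian_conjTranspose_mul_self M).eigenvalues).esymm k := by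
  have h := congrArg Polynomial.roots (Matrix.charpoly_mul_comm' M Mᴴ)
  have hX : ∀ j : ℕ, (X ^ j : ℂ[X]) ≠ 0 := fun j => pow_ne_zero _ X_ne_zero
  rw [roots_mul (mul_ne_zero (hX _) (Matrix.charpoly_monic _).ne_zero),
    roots_mul (mul_ne_zero (hX _) (Matrix.charpoly_monic _).ne_zero), roots_X_pow, roots_X_pow,
    Multiset.nsmul_singleton, Multiset.nsmul_singleton] at h
  have h' := congrArg (fun s => (Multiset.map Complex.re s).esymm k) h
  simp only [Multiset.map_add, Multiset.map_replicate, Complex.zero_re,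
    Multiset.esymm_replicate_zero_add] at h'
  rw [Matrix.IsHermitian.map_eigenvalues_eq, Matrix.IsHermitian.map_eigenvalues_eq, h']

/-- The `k`-th root of the `k`-th elementary symmetric function of the squared singular values. -/
noncomputable def gramRoot [DecidableEq m] (k : ℕ) (M : Matrix m n ℂ) : ℝ :=
  esymmRoot k (Matrix.isHermitian_mul_conjTranspose_self M).eigenvalues

theorem gramRoot_eq [DecidableEq m] [DecidableEq n] (k : ℕ) (M : Matrix m n ℂ) :
    gramRoot k M = esymmRoot k (Matrix.isHermitian_conjTranspose_mul_self M).eigenvalues := by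
  rw [gramRoot, esymmRoot, esymmRoot, esymmOn, esymmOn, esymm_eigenvalues_mul_conjTranspose]

theorem gramRoot_smul [DecidableEq m] {k : ℕ} (hk : k ≠ 0) (c : ℂ) (M : Matrix m n ℂ) :
    gramRoot k (c • M) = Complex.normSq c * gramRoot k M := by
  have hM := Matrix.isHermitian_mul_conjTranspose_self M
  have h : (c • M) * (c • M)ᴴ = hM.eigenvectorUnitary.1
      * Matrix.diagonal (fun j => (((Complex.normSq c • hM.eigenvalues) j : ℝ) : ℂ))
      * hM.eigenvectorUnitary.1ᴴ := by
    have hd : Matrix.diagonal (fun j => (((Complex.normSq c • hM.eigenvalues) j : ℝ) : ℂ))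
        = (c * star c) • Matrix.diagonal (fun j => (hM.eigenvalues j : ℂ)) := by
      rw [← Matrix.diagonal_smul]
      congr 1
      funext j
      simp [Complex.mul_conj]
    rw [hd, Matrix.mul_smul, Matrix.smul_mul (c * star c), ← hM.eq_conj_diagonal,
      Matrix.conjTranspose_smul,
      Matrix.smul_mul, Matrix.mul_smul, smul_smul]
  have h' := (Matrix.isHermitian_mul_conjTranspose_self (c • M)).map_eigenvalues_of_conj_diagonal
    hM.eigenvectorUnitary.2 h
  rw [gramRoot, esymmRoot, esymmOn, h']
  exact esymmRoot_smul hk (Complex.normSq_nonneg c)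
    (Matrix.posSemidef_self_mul_conjTranspose M).eigenvalues_nonneg

/-- For operators acting on the left, `Mᴴ * M` is the Gram matrix to use: completeness of the Kraus
operators makes the outcome matrices sum to it, and its size does not depend on the outcome. -/
theorem sum_gramRoot_left_mul_le [DecidableEq m] [DecidableEq n] {k : ℕ} (hk : k ≠ 0) {I : Type*}
    [Fintype I] {m' : I → Type*} [∀ i, Fintype (m' i)] [∀ i, DecidableEq (m' i)]
    (K : ∀ i, Matrix (m' i) m ℂ)
    (hK : ∑ i, (K i)ᴴ * K i = 1) (M : Matrix m n ℂ) :
    ∑ i, gramRoot k (K i * M) ≤ gramRoot k M := by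
  simp only [gramRoot_eq]
  refine sum_esymmRoot_eigenvalues_le hk
    (fun i => Matrix.posSemidef_conjTranspose_mul_self (K i * M)) _ ?_
  calc ∑ i, (K i * M)ᴴ * (K i * M) = ∑ i, Mᴴ * ((K i)ᴴ * K i) * M := by
        simp only [Matrix.conjTranspose_mul, Matrix.mul_assoc]
    _ = Mᴴ * M := by rw [← Matrix.sum_mul, ← Matrix.mul_sum, hK, Matrix.mul_one]

/-- Operators of the second party multiply amplitudes on the right by a transpose, so here `M * Mᴴ`
is the Gram matrix that decomposes. -/
theorem sum_gramRoot_mul_transpose_le [DecidableEq m] [DecidableEq n] {k : ℕ} (hk : k ≠ 0)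
    {I : Type*} [Fintype I] {n' : I → Type*} [∀ i, Fintype (n' i)]
    (K : ∀ i, Matrix (n' i) n ℂ) (hK : ∑ i, (K i)ᴴ * K i = 1) (M : Matrix m n ℂ) :
    ∑ i, gramRoot k (M * (K i)ᵀ) ≤ gramRoot k M := by
  refine sum_esymmRoot_eigenvalues_le hk
    (fun i => Matrix.posSemidef_self_mul_conjTranspose (M * (K i)ᵀ)) _ ?_
  calc ∑ i, (M * (K i)ᵀ) * (M * (K i)ᵀ)ᴴ = ∑ i, M * ((K i)ᴴ * K i)ᵀ * Mᴴ := by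
        simp only [Matrix.conjTranspose_mul, Matrix.transpose_mul, Matrix.mul_assoc]
        rfl
    _ = M * Mᴴ := by
      rw [← Matrix.sum_mul, ← Matrix.mul_sum, ← Matrix.transpose_sum, hK, Matrix.transpose_one,
        Matrix.mul_one]

end Spectrum

/-! ### Monotonicity under LOCC, and Schmidt coefficients of product states. -/

section LOCC

open scoped ComplexOrder

variable {A B A₂ B₂ : Type} [Fintype A] [Fintype B] [Fintype A₂] [Fintype B₂]

/-- The rank-one operator of the (not necessarily normalised) vector with amplitudes `M`. -/
noncomputable def ampDensity {A B : Type} (M : Matrix A B ℂ) : Matrix (A × B) (A × B) ℂ :=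
  Matrix.vecMulVec (fun p => M p.1 p.2) (star fun p => M p.1 p.2)

theorem conj_vecMulVec_star {m n : Type*} [Fintype n] (X : Matrix m n ℂ) (v : n → ℂ) :
    X * Matrix.vecMulVec v (star v) * Xᴴ = Matrix.vecMulVec (X *ᵥ v) (star (X *ᵥ v)) := by
  rw [Matrix.mul_vecMulVec, Matrix.vecMulVec_mul, Matrix.star_mulVec]

theorem kronecker_one_conj_ampDensity {A' : Type} [DecidableEq B] (K : Matrix A' A ℂ)
    (M : Matrix A B ℂ) :
    (K ⊗ₖ (1 : Matrix B B ℂ)) * ampDensity M * (K ⊗ₖ (1 : Matrix B B ℂ))ᴴ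
      = ampDensity (K * M) := by
  have h : (K ⊗ₖ (1 : Matrix B B ℂ)) *ᵥ (fun p => M p.1 p.2)
      = fun p => (K * M) p.1 p.2 := by
    funext p
    simp [Matrix.mulVec, dotProduct, Fintype.sum_prod_type, Matrix.mul_apply,
      Matrix.one_apply]
  rw [ampDensity, conj_vecMulVec_star, h, ampDensity]

theorem one_kronecker_conj_ampDensity {B' : Type} [DecidableEq A] (K : Matrix B' B ℂ)
    (M : Matrix A B ℂ) :
    ((1 : Matrix A A ℂ) ⊗ₖ K) * ampDensity M * ((1 : Matrix A A ℂ) ⊗ₖ K)ᴴ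
      = ampDensity (M * Kᵀ) := by
  have h : ((1 : Matrix A A ℂ) ⊗ₖ K) *ᵥ (fun p => M p.1 p.2)
      = fun p => (M * Kᵀ) p.1 p.2 := by
    funext p
    simp [Matrix.mulVec, dotProduct, Fintype.sum_prod_type_right, Matrix.mul_apply,
      Matrix.one_apply, mul_comm]
  rw [ampDensity, conj_vecMulVec_star, h, ampDensity]

/-- A protocol maps a pure state to an ensemble of pure states, along which `gramRoot k` does not
increase on average. -/
theorem IsLOCC.exists_ensemble [DecidableEq A] [DecidableEq B] [DecidableEq A₂]
    [DecidableEq B₂] {k : ℕ} (hk : k ≠ 0)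
    {Λ : Matrix (A × B) (A × B) ℂ → Matrix (A₂ × B₂) (A₂ × B₂) ℂ} (hΛ : IsLOCC A₂ B₂ A B Λ)
    (M : Matrix A B ℂ) :
    ∃ (J : Type) (_ : Fintype J) (N : J → Matrix A₂ B₂ ℂ),
      Λ (ampDensity M) = ∑ j, ampDensity (N j) ∧ ∑ j, gramRoot k (N j) ≤ gramRoot k M := by
  induction hΛ with
  | done => exact ⟨Unit, inferInstance, fun _ => M, by simp, by simp⟩
  | alice K hK Λ hΛ ih =>
    choose J hJ N hN hle using fun i => ih i (K i * M)
    refine ⟨Σ i, J i, inferInstance, fun j => N j.1 j.2, ?_, ?_⟩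
    · simp only [kronecker_one_conj_ampDensity, hN, Fintype.sum_sigma]
    · rw [Fintype.sum_sigma]
      exact (Finset.sum_le_sum fun i _ => hle i).trans (sum_gramRoot_left_mul_le hk K hK M)
  | bob K hK Λ hΛ ih =>
    choose J hJ N hN hle using fun i => ih i (M * (K i)ᵀ)
    refine ⟨Σ i, J i, inferInstance, fun j => N j.1 j.2, ?_, ?_⟩
    · simp only [one_kronecker_conj_ampDensity, hN, Fintype.sum_sigma]
    · rw [Fintype.sum_sigma]
      exact (Finset.sum_le_sum fun i _ => hle i).trans (sum_gramRoot_mul_transpose_le hk K hK M)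

/-- A pure state is not a nontrivial mixture: vectors whose rank-one operators sum to that of `v`
are proportional to `v`. -/
theorem exists_eq_smul_of_sum_vecMulVec_eq {J n : Type*} [Fintype J] {u : J → n → ℂ} {v : n → ℂ}
    (hv : v ≠ 0)
    (h : ∑ j, Matrix.vecMulVec (u j) (star (u j)) = Matrix.vecMulVec v (star v)) :
    ∃ c : J → ℂ, (∀ j, u j = c j • v) ∧ ∑ j, Complex.normSq (c j) = 1 := by
  obtain ⟨q, hq⟩ := Function.ne_iff.1 hv
  rw [Pi.zero_apply] at hq
  have hent : ∀ a b, ∑ j, u j a * star (u j b) = v a * star (v b) := fun a b => by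
    have := congrFun (congrFun h a) b
    simpa [Matrix.sum_apply, Matrix.vecMulVec_apply] using this
  have hprop : ∀ j p, u j p * v q = u j q * v p := by
    intro j p
    have hsum : ∑ j, Complex.normSq (u j p * v q - u j q * v p) = 0 := by
      -- Expanding the squares leaves only entries of the summed rank-one operators. These may be
      -- replaced by entries for `v`, for which the 2 × 2 minors vanish.
      have h1 : ∑ j, (Complex.normSq (u j p * v q - u j q * v p) : ℂ)
          = (∑ j, u j p * star (u j p)) * (v q * star (v q))
            - (∑ j, u j p * star (u j q)) * (v q * star (v p))
            - (∑ j, u j q * star (u j p)) * (v p * star (v q))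
            + (∑ j, u j q * star (u j q)) * (v p * star (v p)) := by
        simp only [Finset.sum_mul, ← Finset.sum_sub_distrib, ← Finset.sum_add_distrib]
        refine Finset.sum_congr rfl fun j _ => ?_
        rw [← Complex.mul_conj]
        simp only [map_sub, map_mul, Complex.star_def]
        ring
      rw [hent, hent, hent, hent] at h1
      have h2 : ∑ j, (Complex.normSq (u j p * v q - u j q * v p) : ℂ) = 0 := by
        rw [h1]
        ring
      exact_mod_cast h2
    have h3 := (Finset.sum_eq_zero_iff_of_nonneg fun j _ => Complex.normSq_nonneg _).1 hsum j
      (Finset.mem_univ j)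
    exact sub_eq_zero.1 (Complex.normSq_eq_zero.1 h3)
  refine ⟨fun j => u j q / v q, fun j => ?_, ?_⟩
  · funext p
    rw [Pi.smul_apply, smul_eq_mul, div_mul_eq_mul_div, eq_div_iff hq, hprop]
  · have h1 := hent q q
    simp only [Complex.star_def, Complex.mul_conj] at h1
    have h2 : ∑ j, Complex.normSq (u j q) = Complex.normSq (v q) := by exact_mod_cast h1
    simp only [Complex.normSq_div, ← Finset.sum_div]
    rw [h2, div_self (by simpa using hq)]

theorem PureState.density_eq_ampDensity (ζ : PureState A B) : ζ.density = ampDensity ζ.amp := rfl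

theorem PureState.amp_ne_zero (ζ : PureState A B) : ζ.amp ≠ 0 := fun h => by
  have := ζ.normalized
  simp [h] at this

/-- A pure output forces every branch to be a multiple `c j` of the target. The weights `|c j| ^ 2`
sum to one, so the ensemble average is exactly the value at the target. -/
theorem LOCCConvertible.gramRoot_le [DecidableEq A] [DecidableEq B] [DecidableEq A₂]
    [DecidableEq B₂] {k : ℕ} (hk : k ≠ 0) {ψ : PureState A B}
    {φ : PureState A₂ B₂} (h : LOCCConvertible ψ φ) : gramRoot k φ.amp ≤ gramRoot k ψ.amp := by
  obtain ⟨Λ, hΛ, hmap⟩ := h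
  obtain ⟨J, _, N, hN, hle⟩ := hΛ.exists_ensemble hk ψ.amp
  rw [PureState.density_eq_ampDensity, hN] at hmap
  have hv : (fun p : A₂ × B₂ => φ.amp p.1 p.2) ≠ 0 := fun h0 =>
    φ.amp_ne_zero (Matrix.ext fun a b => congrFun h0 (a, b))
  obtain ⟨c, hc, hc1⟩ := exists_eq_smul_of_sum_vecMulVec_eq hv hmap
  have hNc : ∀ j, N j = c j • φ.amp := fun j => Matrix.ext fun a b => congrFun (hc j) (a, b)
  refine le_trans (le_of_eq ?_) hle
  simp only [hNc, gramRoot_smul hk, ← Finset.sum_mul, hc1, one_mul]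

theorem PureState.schmidtCoeffs_nonneg [DecidableEq A] (ζ : PureState A B) :
    ∀ x ∈ ζ.schmidtCoeffs, 0 ≤ x := by
  intro x hx
  obtain ⟨i, -, rfl⟩ := Multiset.mem_map.1 hx
  have h : ζ.reduced.PosSemidef := by
    rw [ζ.reduced_eq]
    exact Matrix.posSemidef_self_mul_conjTranspose _
  exact h.eigenvalues_nonneg i

theorem PureState.gramRoot_amp [DecidableEq A] (ζ : PureState A B) (k : ℕ) :
    gramRoot k ζ.amp = ζ.schmidtCoeffs.esymm k ^ (1 / (k : ℝ)) := by
  rw [gramRoot, esymmRoot, esymmOn, PureState.schmidtCoeffs]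
  congr 2

/-- Elementary symmetric functions of the Schmidt coefficients do not increase under LOCC. -/
theorem LOCCConvertible.esymm_le [DecidableEq A] [DecidableEq B] [DecidableEq A₂]
    [DecidableEq B₂] {ψ : PureState A B} {φ : PureState A₂ B₂}
    (h : LOCCConvertible ψ φ) (k : ℕ) : φ.schmidtCoeffs.esymm k ≤ ψ.schmidtCoeffs.esymm k := by
  rcases eq_or_ne k 0 with rfl | hk
  · simp [Multiset.esymm_zero_right]
  have h1 := h.gramRoot_le hk
  rw [PureState.gramRoot_amp, PureState.gramRoot_amp] at h1
  exact (Real.rpow_le_rpow_iff (Multiset.esymm_nonneg φ.schmidtCoeffs_nonneg k)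
    (Multiset.esymm_nonneg ψ.schmidtCoeffs_nonneg k) (by positivity)).1 h1

theorem PureState.schmidtCoeffs_sum [DecidableEq A] (ζ : PureState A B) :
    ζ.schmidtCoeffs.sum = 1 := by
  have h := ζ.reduced_isHermitian.trace_eq_sum_eigenvalues
  have h1 : ζ.reduced.trace = 1 := by
    have h2 := congrArg (fun r : ℝ => (r : ℂ)) ζ.normalized
    simp only [Complex.ofReal_one] at h2
    rw [← h2]
    simp [Matrix.trace, PureState.reduced, PureState.density, Complex.mul_conj,
      Complex.normSq_eq_norm_sq]
  rw [h1] at h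
  have h3 : ∑ i, ζ.reduced_isHermitian.eigenvalues i = 1 :=
    Complex.ofReal_injective (by simpa using h.symm)
  exact h3

/-- The reduced matrix is a Kronecker product, diagonalised by the Kronecker product of the two
eigenvector unitaries. -/
theorem PureState.schmidtCoeffs_tensor {A' B' : Type} [DecidableEq A] [Fintype A'] [DecidableEq A']
    [Fintype B'] (ψ : PureState A B) (χ : PureState A' B') :
    (ψ.tensor χ).schmidtCoeffs
      = (ψ.schmidtCoeffs ×ˢ χ.schmidtCoeffs).map fun p => p.1 * p.2 := by
  set U := ψ.reduced_isHermitian.eigenvectorUnitary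
  set V := χ.reduced_isHermitian.eigenvectorUnitary
  have hW : U.1 ⊗ₖ V.1 ∈ Matrix.unitaryGroup (A × A') ℂ := Matrix.kronecker_mem_unitary U.2 V.2
  have h : (ψ.tensor χ).reduced = (U.1 ⊗ₖ V.1)
      * Matrix.diagonal (fun p => ((ψ.reduced_isHermitian.eigenvalues p.1
        * χ.reduced_isHermitian.eigenvalues p.2 : ℝ) : ℂ)) * (U.1 ⊗ₖ V.1)ᴴ := by
    have h1 : (ψ.tensor χ).reduced = ψ.reduced ⊗ₖ χ.reduced := by
      rw [PureState.reduced_eq, PureState.reduced_eq, PureState.reduced_eq, PureState.tensor,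
        Matrix.conjTranspose_kronecker, Matrix.mul_kronecker_mul]
    rw [h1]
    conv_lhs => rw [ψ.reduced_isHermitian.eq_conj_diagonal, χ.reduced_isHermitian.eq_conj_diagonal]
    rw [Matrix.mul_kronecker_mul, Matrix.mul_kronecker_mul, Matrix.conjTranspose_kronecker,
      Matrix.diagonal_kronecker_diagonal]
    simp only [Complex.ofReal_mul]
    rfl
  rw [PureState.schmidtCoeffs,
    (ψ.tensor χ).reduced_isHermitian.map_eigenvalues_of_conj_diagonal hW h]
  have hprod : (Finset.univ : Finset (A × A')).val = Finset.univ.val.product Finset.univ.val := rfl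
  rw [hprod]
  change _ = Multiset.map _ (Multiset.product (Multiset.map _ _) (Multiset.map _ _))
  simp only [Multiset.product, Multiset.map_bind, Multiset.bind_map, Multiset.map_map,
    Function.comp_def]

end LOCC

/-! ### Multisets of pairwise products and their two highest elementary symmetric functions. -/

section NonzeroPart

theorem Multiset.esymm_filter_ne_zero (s : Multiset ℝ) (k : ℕ) :
    (s.filter fun x => x ≠ 0).esymm k = s.esymm k := by
  induction s using Multiset.induction_on generalizing k with
  | empty => simp
  | cons a s ih =>
    by_cases ha : a = 0
    · rw [Multiset.filter_cons_of_neg _ (by simpa using ha), ih, ha, Multiset.esymm_zero_cons]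
    · rw [Multiset.filter_cons_of_pos (p := fun x => x ≠ 0) _ ha]
      cases k with
      | zero => simp only [Multiset.esymm_zero_right]
      | succ k => rw [Multiset.esymm_cons_succ, Multiset.esymm_cons_succ, ih, ih]

theorem Multiset.sum_filter_ne_zero (s : Multiset ℝ) :
    (s.filter fun x => x ≠ 0).sum = s.sum := by
  induction s using Multiset.induction_on with
  | empty => simp
  | cons a s ih =>
    by_cases ha : a = 0
    · rw [Multiset.filter_cons_of_neg _ (by simpa using ha), ih, ha, Multiset.sum_cons, zero_add]
    · rw [Multiset.filter_cons_of_pos (p := fun x => x ≠ 0) _ ha, Multiset.sum_cons,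
        Multiset.sum_cons, ih]

/-- The multiset of all products of an element of `s` and an element of `t`. -/
noncomputable def Multiset.pairProducts (s t : Multiset ℝ) : Multiset ℝ :=
  (s ×ˢ t).map fun p => p.1 * p.2

theorem Multiset.pairProducts_cons (a : ℝ) (s t : Multiset ℝ) :
    (a ::ₘ s).pairProducts t = t.map (a * ·) + s.pairProducts t := by
  simp [Multiset.pairProducts, Multiset.cons_product, Multiset.map_map]

theorem Multiset.zero_pairProducts (t : Multiset ℝ) : (0 : Multiset ℝ).pairProducts t = 0 := by
  simp [Multiset.pairProducts]

theorem Multiset.filter_pairProducts (s t : Multiset ℝ) :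
    ((s.pairProducts t).filter fun x => x ≠ 0)
      = (s.filter fun x => x ≠ 0).pairProducts (t.filter fun x => x ≠ 0) := by
  induction s using Multiset.induction_on with
  | empty => simp [Multiset.zero_pairProducts]
  | cons a s ih =>
    rw [Multiset.pairProducts_cons, Multiset.filter_add, ih, Multiset.filter_map]
    by_cases ha : a = 0
    · rw [Multiset.filter_cons_of_neg _ (by simpa using ha)]
      simp [ha]
    · rw [Multiset.filter_cons_of_pos (p := fun x => x ≠ 0) _ ha, Multiset.pairProducts_cons]
      simp [ha]

theorem Multiset.card_pairProducts (s t : Multiset ℝ) :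
    (s.pairProducts t).card = s.card * t.card := by
  simp [Multiset.pairProducts]

theorem Multiset.prod_pairProducts (s t : Multiset ℝ) :
    (s.pairProducts t).prod = s.prod ^ t.card * t.prod ^ s.card := by
  induction s using Multiset.induction_on with
  | empty => simp [Multiset.zero_pairProducts]
  | cons a s ih =>
    rw [Multiset.pairProducts_cons, Multiset.prod_add, ih, Multiset.prod_map_mul,
      Multiset.prod_cons, Multiset.card_cons]
    simp only [Multiset.map_const', Multiset.prod_replicate, Multiset.map_id']
    ring

/-- This multiplicativity is what lets the catalyst factor out of the second highest elementary
symmetric function. -/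
theorem Multiset.sum_inv_pairProducts (s t : Multiset ℝ) :
    ((s.pairProducts t).map (·⁻¹)).sum = (s.map (·⁻¹)).sum * (t.map (·⁻¹)).sum := by
  induction s using Multiset.induction_on with
  | empty => simp [Multiset.zero_pairProducts]
  | cons a s ih =>
    rw [Multiset.pairProducts_cons, Multiset.map_add, Multiset.sum_add, ih, Multiset.map_cons,
      Multiset.sum_cons, Multiset.map_map, add_mul]
    simp only [Function.comp_def, mul_inv, Multiset.sum_map_mul_left]

theorem Multiset.esymm_card (s : Multiset ℝ) : s.esymm s.card = s.prod := by
  induction s using Multiset.induction_on with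
  | empty => simp [Multiset.esymm_zero_right]
  | cons a s ih =>
    rw [Multiset.card_cons, Multiset.esymm_cons_succ, ih, Multiset.prod_cons, Multiset.esymm,
      Multiset.powersetCard_eq_empty _ (Nat.lt_succ_self _)]
    simp

/-- Each term omits exactly one element, so it is the full product divided by that element. -/
theorem Multiset.esymm_card_sub_one {s : Multiset ℝ} (hs : ∀ x ∈ s, x ≠ 0) (h : s.card ≠ 0) :
    s.esymm (s.card - 1) = s.prod * (s.map (·⁻¹)).sum := by
  induction s using Multiset.induction_on with
  | empty => simp at h
  | cons a s ih =>
    have ha : a ≠ 0 := hs a (Multiset.mem_cons_self a s)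
    rw [Multiset.card_cons, Nat.add_sub_cancel, Multiset.prod_cons, Multiset.map_cons,
      Multiset.sum_cons]
    cases hc : s.card with
    | zero =>
      rw [Multiset.card_eq_zero.1 hc, Multiset.esymm_zero_right]
      simp [ha]
    | succ j =>
      have ih' := ih (fun x hx => hs x (Multiset.mem_cons_of_mem hx)) (by omega)
      rw [hc, Nat.add_sub_cancel] at ih'
      rw [Multiset.esymm_cons_succ, ih', ← hc, Multiset.esymm_card]
      field_simp

theorem Multiset.prod_pos_of_pos {s : Multiset ℝ} (hs : ∀ x ∈ s, 0 < x) : 0 < s.prod := by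
  induction s using Multiset.induction_on with
  | empty => simp
  | cons a s ih =>
    rw [Multiset.prod_cons]
    exact mul_pos (hs a (Multiset.mem_cons_self a s))
      (ih fun x hx => hs x (Multiset.mem_cons_of_mem hx))

theorem Multiset.sum_inv_pos {s : Multiset ℝ} (hs : ∀ x ∈ s, 0 < x) (h : s.card ≠ 0) :
    0 < (s.map (·⁻¹)).sum := by
  refine lt_of_le_of_ne (Multiset.sum_nonneg fun y hy => ?_) fun h0 => ?_
  · obtain ⟨x, hx, rfl⟩ := Multiset.mem_map.1 hy
    exact (inv_pos.2 (hs x hx)).le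
  · obtain ⟨x, hx⟩ := Multiset.exists_mem_of_ne_zero fun h' => h (Multiset.card_eq_zero.2 h')
    have hle := Multiset.single_le_sum (fun y hy => by
      obtain ⟨x, hx, rfl⟩ := Multiset.mem_map.1 hy
      exact (inv_pos.2 (hs x hx)).le) x⁻¹ (Multiset.mem_map_of_mem (·⁻¹) hx)
    linarith [inv_pos.2 (hs x hx)]

end NonzeroPart

/-! ### Nonzero Schmidt coefficients and logarithms of concurrences. -/

namespace PureState

variable {A B : Type} [Fintype A] [DecidableEq A] [Fintype B]

/-- The nonzero Schmidt coefficients. -/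
noncomputable def nonzeroSchmidtCoeffs (ζ : PureState A B) : Multiset ℝ :=
  ζ.schmidtCoeffs.filter fun x => x ≠ 0

theorem nonzeroSchmidtCoeffs_pos (ζ : PureState A B) :
    ∀ x ∈ ζ.nonzeroSchmidtCoeffs, 0 < x := fun x hx => by
  obtain ⟨h, h0⟩ := Multiset.mem_filter.1 hx
  exact lt_of_le_of_ne (ζ.schmidtCoeffs_nonneg x h) (Ne.symm h0)

theorem nonzeroSchmidtCoeffs_sum (ζ : PureState A B) :
    ζ.nonzeroSchmidtCoeffs.sum = 1 := by
  rw [nonzeroSchmidtCoeffs, Multiset.sum_filter_ne_zero, ζ.schmidtCoeffs_sum]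

theorem schmidtRank_ne_zero (ζ : PureState A B) : ζ.schmidtRank ≠ 0 := fun h => by
  have h1 := ζ.nonzeroSchmidtCoeffs_sum
  rw [nonzeroSchmidtCoeffs, Multiset.card_eq_zero.1 h] at h1
  simp at h1

theorem log_concurrence (ζ : PureState A B) {n k : ℕ}
    (h : 0 < ζ.nonzeroSchmidtCoeffs.esymm k)
    (hn : 0 < (Multiset.replicate n (1 / (n : ℝ))).esymm k) :
    Real.log (ζ.concurrence n k) = 1 / (k : ℝ) * (Real.log (ζ.nonzeroSchmidtCoeffs.esymm k)
      - Real.log ((Multiset.replicate n (1 / (n : ℝ))).esymm k)) := by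
  rw [nonzeroSchmidtCoeffs, Multiset.esymm_filter_ne_zero] at h ⊢
  rw [concurrence, Real.log_rpow (div_pos h hn), Real.log_div h.ne' hn.ne']

theorem esymm_schmidtCoeffs_tensor {A' B' : Type} [Fintype A'] [DecidableEq A'] [Fintype B']
    (ψ : PureState A B) (χ : PureState A' B') (k : ℕ) :
    (ψ.tensor χ).schmidtCoeffs.esymm k
      = (ψ.nonzeroSchmidtCoeffs.pairProducts χ.nonzeroSchmidtCoeffs).esymm k := by
  rw [schmidtCoeffs_tensor, nonzeroSchmidtCoeffs, nonzeroSchmidtCoeffs,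
    ← Multiset.filter_pairProducts, Multiset.esymm_filter_ne_zero, Multiset.pairProducts]

end PureState

/-! ### The bound on the rank of the catalyst. -/

theorem proposition2 {A B A' B' : Type}
    [Fintype A] [DecidableEq A] [Fintype B] [DecidableEq B]
    [Fintype A'] [DecidableEq A'] [Fintype B'] [DecidableEq B']
    (ψ φ : PureState A B) (χ : PureState A' B') (d b : ℕ)
    (hψ : ψ.schmidtRank = d) (hφ : φ.schmidtRank = d) (hχ : χ.schmidtRank = b)
    (hLOCC : LOCCConvertible (ψ.tensor χ) (φ.tensor χ))
    (hne : ψ.concurrence d d ≠ φ.concurrence d d) :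
    (b : ℝ) ≥ 1 + (((d : ℝ) - 1) / (d : ℝ)) *
      ((Real.log (φ.concurrence d (d - 1)) - Real.log (ψ.concurrence d (d - 1))) /
        (Real.log (ψ.concurrence d d) - Real.log (φ.concurrence d d))) := by
  have hd0 : d ≠ 0 := hψ ▸ ψ.schmidtRank_ne_zero
  have hb0 : b ≠ 0 := hχ ▸ χ.schmidtRank_ne_zero
  have hα : ψ.nonzeroSchmidtCoeffs.card = d := hψ
  have hβ : φ.nonzeroSchmidtCoeffs.card = d := hφ
  have hγ : χ.nonzeroSchmidtCoeffs.card = b := hχ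
  have hLog : ∀ k, _ := fun k => hLOCC.esymm_le k
  simp only [PureState.esymm_schmidtCoeffs_tensor] at hLog
  have hlogψ := fun k => ψ.log_concurrence (n := d) (k := k)
  have hlogφ := fun k => φ.log_concurrence (n := d) (k := k)
  have hαsum := ψ.nonzeroSchmidtCoeffs_sum
  have hβsum := φ.nonzeroSchmidtCoeffs_sum
  have hCψ : ψ.concurrence d d = (ψ.nonzeroSchmidtCoeffs.esymm d
      / (Multiset.replicate d (1 / (d : ℝ))).esymm d) ^ (1 / (d : ℝ)) := by
    rw [PureState.concurrence, PureState.nonzeroSchmidtCoeffs, Multiset.esymm_filter_ne_zero]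
  have hCφ : φ.concurrence d d = (φ.nonzeroSchmidtCoeffs.esymm d
      / (Multiset.replicate d (1 / (d : ℝ))).esymm d) ^ (1 / (d : ℝ)) := by
    rw [PureState.concurrence, PureState.nonzeroSchmidtCoeffs, Multiset.esymm_filter_ne_zero]
  have hαpos := ψ.nonzeroSchmidtCoeffs_pos
  have hβpos := φ.nonzeroSchmidtCoeffs_pos
  have hγpos := χ.nonzeroSchmidtCoeffs_pos
  generalize ψ.nonzeroSchmidtCoeffs = α at *
  generalize φ.nonzeroSchmidtCoeffs = β at *
  generalize χ.nonzeroSchmidtCoeffs = γ at *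
  have hdR : (0 : ℝ) < d := by positivity
  have hτpos : ∀ x ∈ Multiset.replicate d (1 / (d : ℝ)), 0 < x := fun x hx => by
    rw [Multiset.eq_of_mem_replicate hx]
    positivity
  have hτ : (Multiset.replicate d (1 / (d : ℝ))).card = d := Multiset.card_replicate _ _
  -- Only the size and positivity of the uniform spectrum matter, since the normalising constants
  -- cancel between ψ and φ.
  generalize Multiset.replicate d (1 / (d : ℝ)) = τ at *
  have hprod : ∀ s : Multiset ℝ, s.card = d → s.esymm d = s.prod := fun s hs => by
    rw [← hs, Multiset.esymm_card]
  -- For `d = 1` both spectra are `{1}`, so the concurrences would agree. Excluding this makes `1 /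
  -- (d - 1)` meaningful.
  have hd1 : d ≠ 1 := by
    rintro rfl
    obtain ⟨x, rfl⟩ := Multiset.card_eq_one.1 hα
    obtain ⟨y, rfl⟩ := Multiset.card_eq_one.1 hβ
    rw [Multiset.sum_singleton] at hαsum hβsum
    rw [hCψ, hCφ, hαsum, hβsum] at hne
    exact hne rfl
  have hesymm : ∀ s : Multiset ℝ, (∀ x ∈ s, 0 < x) → s.card = d →
      s.esymm (d - 1) = s.prod * (s.map (·⁻¹)).sum := fun s hs hc => by
    rw [← hc]
    exact Multiset.esymm_card_sub_one (fun x hx => (hs x hx).ne') (hc ▸ hd0)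
  have hP := Multiset.prod_pos_of_pos hαpos
  have hQ := Multiset.prod_pos_of_pos hβpos
  have hG := Multiset.prod_pos_of_pos hγpos
  have hS := Multiset.sum_inv_pos hαpos (hα ▸ hd0)
  have hT := Multiset.sum_inv_pos hβpos (hβ ▸ hd0)
  have hR := Multiset.sum_inv_pos hγpos (hγ ▸ hb0)
  have hτprod := Multiset.prod_pos_of_pos hτpos
  have hτinv := Multiset.sum_inv_pos hτpos (hτ ▸ hd0)
  have hpair : ∀ s : Multiset ℝ, s.card = d → (s.pairProducts γ).card = d * b := fun s hs => by
    rw [Multiset.card_pairProducts, hs, hγ]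
  have hpairne : ∀ s : Multiset ℝ, (∀ x ∈ s, 0 < x) → ∀ x ∈ s.pairProducts γ, x ≠ 0 := by
    intro s hs x hx
    obtain ⟨p, hp, rfl⟩ := Multiset.mem_map.1 hx
    obtain ⟨h1, h2⟩ := Multiset.mem_product.1 hp
    exact (mul_pos (hs _ h1) (hγpos _ h2)).ne'
  have hfull : ∀ s : Multiset ℝ, s.card = d →
      (s.pairProducts γ).esymm (d * b) = s.prod ^ b * γ.prod ^ d := fun s hs => by
    rw [← hpair s hs, Multiset.esymm_card, Multiset.prod_pairProducts, hs, hγ]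
  have hpenult : ∀ s : Multiset ℝ, (∀ x ∈ s, 0 < x) → s.card = d →
      (s.pairProducts γ).esymm (d * b - 1)
        = s.prod ^ b * (s.map (·⁻¹)).sum * (γ.prod ^ d * (γ.map (·⁻¹)).sum) := fun s hs hc => by
    rw [← hpair s hc, Multiset.esymm_card_sub_one (hpairne s hs)
      (hpair s hc ▸ mul_ne_zero hd0 hb0), Multiset.prod_pairProducts,
      Multiset.sum_inv_pairProducts, hc, hγ]
    ring
  have h1 := hLog (d * b)
  have h2 := hLog (d * b - 1)
  rw [hfull α hα, hfull β hβ] at h1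
  rw [hpenult α hαpos hα, hpenult β hβpos hβ] at h2
  have hQP : β.prod ≤ α.prod :=
    (pow_le_pow_iff_left₀ hQ.le hP.le hb0).1 (le_of_mul_le_mul_right h1 (by positivity))
  have hQPne : β.prod ≠ α.prod := fun h => hne (by rw [hCψ, hCφ, hprod α hα, hprod β hβ, h])
  -- The common positive factor from χ is cancelled, leaving `Q^b T ≤ P^b S`.
  have hmono := le_of_mul_le_mul_right h2 (by positivity)
  have hlogs := Real.log_le_log (by positivity) hmono
  rw [Real.log_mul (by positivity) hT.ne', Real.log_mul (by positivity) hS.ne', Real.log_pow,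
    Real.log_pow] at hlogs
  have hlt := Real.log_lt_log hQ (lt_of_le_of_ne hQP hQPne)
  have hd1R : (0 : ℝ) < (d : ℝ) - 1 := by
    have : (1 : ℝ) < d := by exact_mod_cast (show 1 < d by omega)
    linarith
  have hcast : ((d - 1 : ℕ) : ℝ) = (d : ℝ) - 1 := by
    rw [Nat.cast_sub (by omega), Nat.cast_one]
  rw [hlogψ d (by rw [hprod α hα]; exact hP) (by rw [hprod τ hτ]; exact hτprod),
    hlogφ d (by rw [hprod β hβ]; exact hQ) (by rw [hprod τ hτ]; exact hτprod),
    hlogψ (d - 1) (by rw [hesymm α hαpos hα]; positivity)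
      (by rw [hesymm τ hτpos hτ]; positivity),
    hlogφ (d - 1) (by rw [hesymm β hβpos hβ]; positivity)
      (by rw [hesymm τ hτpos hτ]; positivity),
    hprod α hα, hprod β hβ, hesymm α hαpos hα, hesymm β hβpos hβ, Real.log_mul hP.ne' hS.ne',
    Real.log_mul hQ.ne' hT.ne', hcast]
  have hΔ : 0 < Real.log α.prod - Real.log β.prod := sub_pos.2 hlt
  -- Here `p, q, s, t` stand for the logarithms of P, Q, S, T. The factor `(d - 1) / d` removes the
  -- roots, and the result is `-1 + (t - s) / (p - q)`, whose `-1` offsets the `1` in the bound.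
  have hfrac : ∀ p q s t c c' : ℝ, 0 < p - q →
      ((d : ℝ) - 1) / d * ((1 / ((d : ℝ) - 1) * (q + t - c) - 1 / ((d : ℝ) - 1) * (p + s - c))
        / (1 / (d : ℝ) * (p - c') - 1 / (d : ℝ) * (q - c')))
        = (q + t - (p + s)) / (p - q) := by
    intro p q s t c c' h
    rw [← mul_sub, ← mul_sub, show p - c' - (q - c') = p - q by ring,
      show q + t - c - (p + s - c) = q + t - (p + s) by ring]
    have := h.ne'
    have := hd1R.ne'
    field_simp
  rw [hfrac _ _ _ _ _ _ hΔ, ge_iff_le, ← le_sub_iff_add_le', div_le_iff₀ hΔ]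
  linarith
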